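/- Let $M$ be a finite-dimensional smooth manifold (Hausdorff, second countable, without boundary) with a smooth affine connection $\nabla$ and a smooth Riemannian metric, used only to measure lengths ($\nabla$ may be its Levi-Civita connection, but need not be). A \emph{minimal geodesic segment} from $p$ to $q$ is a smooth curve $\sigma:[0,1]\to M$ from $p$ to $q$ with $\nabla_{\dot\sigma}\dot\sigma=0$ whose length is the infimum of the lengths of all $C^1$ curves from $p$ to $q$. A set $C\subseteq M$ is \emph{geodesically convex} if every minimal geodesic segment joining two points of $C$ is contained in $C$. For a complete $C^\infty$ vector field $X$ with flow $X_t$, a point $a\in M$ is an \emph{attractor} of $X$ if $X(a)=0$ and $\lim_{t\to\infty}X_t(x)=a$ for every $x\in M$. Let $\Gamma$ be a nonempty family of complete $C^\infty$ vector fields on $M$, regarded as a control system with piecewise constant controls: a control $u$ chooses switching times $0=t_0<t_1<t_2<\cdots\to\infty$ and fields $X_0,X_1,\ldots\in\Gamma$, and $\phi(\cdot,x,u)$ is the continuous curve on $[0,\infty)$ that starts at $x$ and is an integral curve of $X_n$ on $[t_n,t_{n+1}]$. Let $\mathcal O^+(x)=\{\phi(t,x,u) : t>0,\ u \text{ a control}\}$.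 A nonempty set $C\subseteq M$ is an \emph{invariant control set} of $\Gamma$ if (i) for every $x\in C$ there is a control $u$ with $\phi(t,x,u)\in C$ for all $t\ge 0$; (ii) $\operatorname{cl}C=\operatorname{cl}\mathcal O^+(x)$ for every $x\in C$; and (iii) $C$ is maximal, that is, every $C'\supseteq C$ that satisfies (i) and (ii) equals $C$. \textbf{Theorem.} Suppose that every $X\in\Gamma$ satisfies $\nabla_XX=c_XX$ for some smooth function $c_X:M\to\mathbb R$, that every $X\in\Gamma$ has exactly one attractor $a$, and that for every $x\in M$ the trajectory $t\mapsto X_t(x)$, $t\ge 0$, together with its limit $a$, is, up to a change of parameter, a minimal geodesic segment from $x$ to $a$: there are a minimal geodesic segment $\sigma$ from $x$ to $a$ and a continuous strictly increasing $\tau:[0,\infty)\to[0,1)$ with $\tau(0)=0$, $\lim_{t\to\infty}\tau(t)=1$ and $X_t(x)=\sigma(\tau(t))$ for all $t\ge 0$. If the set $$E=\{a\in M : a \text{ is an attractor of some } X\in\Gamma\}$$ is closed and geodesically convex, then $E$ is the invariant control set of $\Gamma$. That is, $E$ is an invariant control set of $\Gamma$, it is the only closed one, and $$E=\bigcap_{x\in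 M}\operatorname{cl}\mathcal O^+(x).$$ -/

import Mathlib

open Set Filter Topology Manifold Bundle
open scoped ContDiff

noncomputable section

namespace GeodesicControl

/-! Throughout, `M` is a smooth manifold without boundary, modelled on a finite-dimensional real
vector space `E`. -/

section VectorFields

variable {E : Type*} [NormedAddCommGroup E] [NormedSpace ℝ E]
  {M : Type*} [TopologicalSpace M] [ChartedSpace E M] [IsManifold 𝓘(ℝ, E) ∞ M]

variable (E M) in
/-- A complete smooth vector field on `M`: through every point passes an integral curve that is
defined for all times. -/
structure CompleteVectorField where
  /-- The underlying vector field. -/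
  toFun : ∀ x : M, TangentSpace 𝓘(ℝ, E) x
  smooth : ContMDiff 𝓘(ℝ, E) 𝓘(ℝ, E).tangent ∞
    (fun x ↦ (⟨x, toFun x⟩ : TangentBundle 𝓘(ℝ, E) M))
  complete : ∀ x : M, ∃ γ : ℝ → M, γ 0 = x ∧ IsMIntegralCurve γ toFun

namespace CompleteVectorField

/-- The flow `X_t(x)`: the value at time `t` of the integral curve of `X` that starts at `x`
(on a Hausdorff manifold this curve is unique). -/
def flow (X : CompleteVectorField E M) (t : ℝ) (x : M) : M :=
  (X.complete x).choose t

lemma flow_zero (X : CompleteVectorField E M) (x : M) : X.flow 0 x = x :=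
  (X.complete x).choose_spec.1

lemma isMIntegralCurve_flow (X : CompleteVectorField E M) (x : M) :
    IsMIntegralCurve (fun t ↦ X.flow t x) X.toFun :=
  (X.complete x).choose_spec.2

/-- `a` is an attractor of `X`: the field vanishes at `a`, and `X_t(x) → a` as `t → ∞` for every
initial state `x` in `M`. -/
structure IsAttractor (X : CompleteVectorField E M) (a : M) : Prop where
  vanishes : X.toFun a = 0
  attracts : ∀ x : M, Tendsto (fun t ↦ X.flow t x) atTop (𝓝 a)

end CompleteVectorField

/-- The set of all attractors of the members of `Γ`. -/
def attractorSet (Γ : Set (CompleteVectorField E M)) : Set M :=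
  {a | ∃ X ∈ Γ, X.IsAttractor a}

/-! ### Control systems and invariant control sets -/

/-- A piecewise constant control on `[0, ∞)` for the control system `Γ`: the field `field n ∈ Γ` is
used during the time interval from `time n` to `time (n + 1)`. -/
structure Control (Γ : Set (CompleteVectorField E M)) where
  /-- The switching times. -/
  time : ℕ → ℝ
  /-- The field used between two consecutive switching times. -/
  field : ℕ → CompleteVectorField E M
  time_zero : time 0 = 0
  strictMono_time : StrictMono time
  tendsto_time : Tendsto time atTop atTop
  field_mem : ∀ n, field n ∈ Γ

/-- `γ` is (on `[0, ∞)`) the solution `φ(·, x, u)`: it starts at `x` and runs, between two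
consecutive switching times, along the integral curve of the field that is then in use. -/
def Control.IsSolution {Γ : Set (CompleteVectorField E M)} (u : Control Γ) (x : M)
    (γ : ℝ → M) : Prop :=
  γ 0 = x ∧ ∀ n : ℕ, ∀ t ∈ Icc (u.time n) (u.time (n + 1)),
    γ t = (u.field n).flow (t - u.time n) (γ (u.time n))

/-- The positive orbit of `x` at time exactly `t`. -/
def positiveOrbitAt (Γ : Set (CompleteVectorField E M)) (t : ℝ) (x : M) : Set M :=
  {y | ∃ (u : Control Γ) (γ : ℝ → M), u.IsSolution x γ ∧ γ t = y}

/-- The positive orbit of `x`, the union over `t > 0` of the orbits at time `t`. -/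
def positiveOrbit (Γ : Set (CompleteVectorField E M)) (x : M) : Set M :=
  ⋃ t : ℝ, ⋃ _ : 0 < t, positiveOrbitAt Γ t x

/-- From every point of `C` some control keeps the solution in `C` for all times `t ≥ 0`. -/
def StaysInside (Γ : Set (CompleteVectorField E M)) (C : Set M) : Prop :=
  ∀ x ∈ C, ∃ (u : Control Γ) (γ : ℝ → M), u.IsSolution x γ ∧ ∀ t : ℝ, 0 ≤ t → γ t ∈ C

/-- The positive orbit of every point of `C` has the same closure as `C`. -/
def ClosureEqOrbits (Γ : Set (CompleteVectorField E M)) (C : Set M) : Prop :=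
  ∀ x ∈ C, closure C = closure (positiveOrbit Γ x)

/-- Invariant control sets of the control system `Γ`. -/
structure IsInvariantControlSet (Γ : Set (CompleteVectorField E M)) (C : Set M) : Prop where
  nonempty : C.Nonempty
  stays : StaysInside Γ C
  closure_eq : ClosureEqOrbits Γ C
  maximal : ∀ C' : Set M, C ⊆ C' → StaysInside Γ C' → ClosureEqOrbits Γ C' → C' = C

end VectorFields

/-! ### Geodesics -/

section Geodesics

variable {E : Type*} [NormedAddCommGroup E] [NormedSpace ℝ E]
  {M : Type*} [TopologicalSpace M] [ChartedSpace E M] [IsManifold 𝓘(ℝ, E) ∞ M]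

/-- The vector field, defined on the domain of the preferred chart at `x₀` (and zero elsewhere),
whose coordinates in that chart are constantly `v`. -/
def coordField (x₀ : M) (v : E) (y : M) : TangentSpace 𝓘(ℝ, E) y :=
  (trivializationAt E (TangentSpace 𝓘(ℝ, E)) x₀).symmL ℝ y v

/-- The covariant acceleration `∇_{γ'} γ'` of a smooth curve `γ` at the time `t`, computed in the
preferred chart at `γ t`: with `c` the curve in this chart and `v = c'(t)`, it is `c''(t)` plus the
covariant derivative in the direction `v` of the field with constant coordinates `v`, that is,
the vector with coordinates `c''ᵏ + Γᵏᵢⱼ c'ⁱ c'ʲ`. -/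
def acceleration (nabla : CovariantDerivative 𝓘(ℝ, E) E (fun x : M ↦ TangentSpace 𝓘(ℝ, E) x))
    (γ : ℝ → M) (t : ℝ) : TangentSpace 𝓘(ℝ, E) (γ t) :=
  let c : ℝ → E := fun s ↦ extChartAt 𝓘(ℝ, E) (γ t) (γ s)
  let v : E := deriv c t
  let w : E := deriv (deriv c) t
  (show TangentSpace 𝓘(ℝ, E) (γ t) from w) +
    nabla (coordField (γ t) v) (γ t) (show TangentSpace 𝓘(ℝ, E) (γ t) from v)

variable [RiemannianBundle (fun x : M ↦ TangentSpace 𝓘(ℝ, E) x)]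

/-- `σ`, restricted to `[0, 1]`, is a minimal geodesic segment from `p` to `q`: a smooth curve from
`p` to `q` which is a geodesic of `nabla`, and whose Riemannian length is the infimum of the
lengths of all `C¹` curves from `p` to `q`. -/
structure IsMinimalGeodesic
    (nabla : CovariantDerivative 𝓘(ℝ, E) E (fun x : M ↦ TangentSpace 𝓘(ℝ, E) x))
    (σ : ℝ → M) (p q : M) : Prop where
  source : σ 0 = p
  target : σ 1 = q
  smooth : ContMDiffOn 𝓘(ℝ, ℝ) 𝓘(ℝ, E) ∞ σ (Icc 0 1)
  geodesic : ∀ t ∈ Ioo (0 : ℝ) 1, acceleration nabla σ t = 0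
  minimal : pathELength 𝓘(ℝ, E) σ 0 1 = riemannianEDist 𝓘(ℝ, E) p q

/-- `C` is geodesically convex: every minimal geodesic segment joining two points of `C` is
contained in `C`. -/
def IsGeodesicallyConvex
    (nabla : CovariantDerivative 𝓘(ℝ, E) E (fun x : M ↦ TangentSpace 𝓘(ℝ, E) x))
    (C : Set M) : Prop :=
  ∀ p ∈ C, ∀ q ∈ C, ∀ σ : ℝ → M, IsMinimalGeodesic nabla σ p q → σ '' Icc 0 1 ⊆ C

/-- Up to a change of parameter, the trajectory `t ↦ X_t(x)`, `t ≥ 0`, followed by its limit `a`,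
is a minimal geodesic segment from `x` to `a`. -/
def TrajectoryIsMinimalGeodesic
    (nabla : CovariantDerivative 𝓘(ℝ, E) E (fun x : M ↦ TangentSpace 𝓘(ℝ, E) x))
    (X : CompleteVectorField E M) (x a : M) : Prop :=
  ∃ (σ : ℝ → M) (τ : ℝ → ℝ), IsMinimalGeodesic nabla σ x a ∧
    τ 0 = 0 ∧ ContinuousOn τ (Ici 0) ∧ StrictMonoOn τ (Ici 0) ∧ Tendsto τ atTop (𝓝 1) ∧
    ∀ t : ℝ, 0 ≤ t → X.flow t x = σ (τ t)

end Geodesics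

end GeodesicControl

end

namespace GeodesicControl

section Flow

variable {E : Type*} [NormedAddCommGroup E] [NormedSpace ℝ E]
  {M : Type*} [TopologicalSpace M] [ChartedSpace E M] [IsManifold 𝓘(ℝ, E) ∞ M]

/-! Write `A` for the attractor set. Running one field forever brings any state to its attractor, so
`A` lies in the closure of every positive orbit. Conversely, a trajectory starting in `A` follows a
minimal geodesic between two points of `A`, so convexity keeps it there, and switching fields cannot
lead out. As `A` is closed, orbit closures from points of `A` are exactly `A`. Maximality,
uniqueness and the intersection formula all follow by comparing closures at a point of `A`. -/

/-- The semigroup property of the flow of a complete vector field on a Hausdorff manifold. -/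
lemma CompleteVectorField.flow_add [CompleteSpace E] [T2Space M] (X : CompleteVectorField E M)
    (s t : ℝ) (x : M) : X.flow (s + t) x = X.flow s (X.flow t x) := by
  have h1 : IsMIntegralCurve ((fun r ↦ X.flow r x) ∘ (· + t)) X.toFun :=
    (X.isMIntegralCurve_flow x).comp_add t
  have h2 := X.isMIntegralCurve_flow (X.flow t x)
  have hX : ContMDiff 𝓘(ℝ, E) 𝓘(ℝ, E).tangent 1
      (fun x ↦ (⟨x, X.toFun x⟩ : TangentBundle 𝓘(ℝ, E) M)) := X.smooth.of_le (by simp)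
  -- `flow` picks an integral curve separately for each initial point, so the two curves can be
  -- compared only through uniqueness.
  have h := isMIntegralCurve_Ioo_eq_of_contMDiff_boundaryless (t₀ := 0) hX h1 h2
    (by simp [X.flow_zero])
  exact congrFun h s

variable {Γ : Set (CompleteVectorField E M)}

/-- The control that uses the same field at all times. -/
def Control.const {X : CompleteVectorField E M} (hX : X ∈ Γ) : Control Γ where
  time n := n
  field _ := X
  time_zero := Nat.cast_zero
  strictMono_time := Nat.strictMono_cast
  tendsto_time := tendsto_natCast_atTop_atTop
  field_mem _ := hX

lemma Control.isSolution_const [CompleteSpace E] [T2Space M] {X : CompleteVectorField E M}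
    (hX : X ∈ Γ) (x : M) : (Control.const hX).IsSolution x (fun t ↦ X.flow t x) := by
  refine ⟨X.flow_zero x, fun n t _ ↦ ?_⟩
  change X.flow t x = X.flow (t - n) (X.flow n x)
  rw [← X.flow_add, sub_add_cancel]

/-- The attractors of the members of `Γ` can be approached from every initial state. -/
lemma attractorSet_subset_closure_positiveOrbit [CompleteSpace E] [T2Space M] (x : M) :
    attractorSet Γ ⊆ closure (positiveOrbit Γ x) := by
  rintro a ⟨X, hX, ha⟩
  refine mem_closure_of_tendsto (ha.attracts x) ?_
  filter_upwards [eventually_gt_atTop 0] with t ht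
  exact mem_iUnion₂.2 ⟨t, ht, .const hX, _, Control.isSolution_const hX x, rfl⟩

/-- A set that is positively invariant under the flows of all members of `Γ` contains the
solutions that start in it. -/
lemma Control.IsSolution.mem_of_forall_flow_mem {C : Set M}
    (hC : ∀ X ∈ Γ, ∀ x ∈ C, ∀ t : ℝ, 0 ≤ t → X.flow t x ∈ C)
    {u : Control Γ} {x : M} {γ : ℝ → M} (h : u.IsSolution x γ) (hx : x ∈ C)
    {t : ℝ} (ht : 0 ≤ t) : γ t ∈ C := by
  have step : ∀ n, γ (u.time n) ∈ C → ∀ s ∈ Icc (u.time n) (u.time (n + 1)), γ s ∈ C := by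
    intro n hn s hs
    rw [h.2 n s hs]
    exact hC _ (u.field_mem n) _ hn _ (sub_nonneg.2 hs.1)
  have hmem : ∀ n, γ (u.time n) ∈ C := by
    intro n
    induction n with
    | zero => rwa [u.time_zero, h.1]
    | succ n ih => exact step n ih _ (right_mem_Icc.2 (u.strictMono_time n.lt_succ_self).le)
  -- Induction on a switching time beyond `t` avoids locating the interval that contains `t`; such a
  -- time exists because the switching times diverge.
  have reach : ∀ n, t ≤ u.time n → γ t ∈ C := by
    intro n
    induction n with
    | zero =>
      intro hn
      rw [u.time_zero] at hn
      rw [le_antisymm hn ht, h.1]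
      exact hx
    | succ n ih =>
      intro hn
      rcases le_total t (u.time n) with h' | h'
      · exact ih h'
      · exact step n (hmem n) t ⟨h', hn⟩
  obtain ⟨n, hn⟩ := (u.tendsto_time.eventually_ge_atTop t).exists
  exact reach n hn

end Flow

section Convexity

variable {E : Type*} [NormedAddCommGroup E] [NormedSpace ℝ E]
  {M : Type*} [TopologicalSpace M] [ChartedSpace E M] [IsManifold 𝓘(ℝ, E) ∞ M]
  [RiemannianBundle (fun x : M ↦ TangentSpace 𝓘(ℝ, E) x)]

/-- A trajectory that runs along a minimal geodesic between two points of a geodesically convex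
set does not leave this set. -/
lemma IsGeodesicallyConvex.flow_mem
    {nabla : CovariantDerivative 𝓘(ℝ, E) E (fun x : M ↦ TangentSpace 𝓘(ℝ, E) x)}
    {C : Set M} (hC : IsGeodesicallyConvex nabla C) {X : CompleteVectorField E M} {x a : M}
    (hx : x ∈ C) (ha : a ∈ C) (h : TrajectoryIsMinimalGeodesic nabla X x a)
    {t : ℝ} (ht : 0 ≤ t) : X.flow t x ∈ C := by
  obtain ⟨σ, τ, hσ, hτ0, -, hτ, hτ1, hflow⟩ := h
  rw [hflow t ht]
  refine hC x hx a ha σ hσ (mem_image_of_mem σ ⟨?_, ?_⟩)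
  · rw [← hτ0]
    exact hτ.monotoneOn self_mem_Ici ht ht
  -- An increasing function stays below its limit, here `1`.
  · refine ge_of_tendsto hτ1 ?_
    filter_upwards [eventually_ge_atTop t] with s hs
    exact hτ.monotoneOn ht (ht.trans hs) hs

end Convexity

end GeodesicControl

theorem mainTheorem1
    {E : Type*} [NormedAddCommGroup E] [NormedSpace ℝ E] [FiniteDimensional ℝ E]
    {M : Type*} [TopologicalSpace M] [T2Space M] [SecondCountableTopology M]
    [ChartedSpace E M] [IsManifold 𝓘(ℝ, E) ∞ M]
    [RiemannianBundle (fun x : M ↦ TangentSpace 𝓘(ℝ, E) x)]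
    [IsContMDiffRiemannianBundle 𝓘(ℝ, E) ∞ E (fun x : M ↦ TangentSpace 𝓘(ℝ, E) x)]
    (nabla : CovariantDerivative 𝓘(ℝ, E) E (fun x : M ↦ TangentSpace 𝓘(ℝ, E) x))
    [CovariantDerivative.ContMDiffCovariantDerivative nabla ∞]
    (Γ : Set (GeodesicControl.CompleteVectorField E M)) (hΓ : Γ.Nonempty)
    (hgeod : ∀ X ∈ Γ, ∃ c : M → ℝ, ContMDiff 𝓘(ℝ, E) 𝓘(ℝ, ℝ) ∞ c ∧
      ∀ x : M, nabla X.toFun x (X.toFun x) = c x • X.toFun x)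
    (hattr : ∀ X ∈ Γ, ∃! a : M, X.IsAttractor a)
    (htraj : ∀ X ∈ Γ, ∀ a : M, X.IsAttractor a → ∀ x : M,
      GeodesicControl.TrajectoryIsMinimalGeodesic nabla X x a)
    (hclosed : IsClosed (GeodesicControl.attractorSet Γ))
    (hconvex : GeodesicControl.IsGeodesicallyConvex nabla (GeodesicControl.attractorSet Γ)) :
    GeodesicControl.IsInvariantControlSet Γ (GeodesicControl.attractorSet Γ) ∧
    (∀ D : Set M, GeodesicControl.IsInvariantControlSet Γ D → IsClosed D →
      D = GeodesicControl.attractorSet Γ) ∧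
    GeodesicControl.attractorSet Γ =
      ⋂ x : M, closure (GeodesicControl.positiveOrbit Γ x) := by
  have : CompleteSpace E := FiniteDimensional.complete ℝ E
  set A := GeodesicControl.attractorSet Γ
  have flow_mem : ∀ X ∈ Γ, ∀ x ∈ A, ∀ t : ℝ, 0 ≤ t → X.flow t x ∈ A := by
    intro X hX x hx t ht
    obtain ⟨a, ha, -⟩ := hattr X hX
    exact hconvex.flow_mem hx ⟨X, hX, ha⟩ (htraj X hX a ha x) ht
  have closure_orbit : ∀ x ∈ A, closure (GeodesicControl.positiveOrbit Γ x) = A := by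
    intro x hx
    refine (closure_minimal ?_ hclosed).antisymm
      (GeodesicControl.attractorSet_subset_closure_positiveOrbit x)
    intro y hy
    obtain ⟨t, ht, u, γ, hγ, rfl⟩ := mem_iUnion₂.1 hy
    exact hγ.mem_of_forall_flow_mem flow_mem hx ht.le
  obtain ⟨X, hX⟩ := hΓ
  obtain ⟨a, ha, -⟩ := hattr X hX
  have haA : a ∈ A := ⟨X, hX, ha⟩
  -- Evaluating the closure condition at `a ∈ A` gives `closure C = A`. This serves both maximality
  -- and uniqueness.
  have hmax : ∀ C : Set M, A ⊆ C → GeodesicControl.ClosureEqOrbits Γ C → C = A := by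
    intro C hAC hC
    refine Subset.antisymm ?_ hAC
    rw [← closure_orbit a haA, ← hC a (hAC haA)]
    exact subset_closure
  refine ⟨⟨⟨a, haA⟩, ?_, ?_, fun C hAC _ hC ↦ hmax C hAC hC⟩, ?_, ?_⟩
  · exact fun x hx ↦ ⟨_, _, GeodesicControl.Control.isSolution_const hX x, flow_mem X hX x hx⟩
  · intro x hx
    rw [closure_orbit x hx, hclosed.closure_eq]
  · intro D hD hDclosed
    refine hmax D ?_ hD.closure_eq
    obtain ⟨x, hx⟩ := hD.nonempty
    -- Closedness makes `D` itself an orbit closure, and every orbit closure contains `A`.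
    rw [← hDclosed.closure_eq, hD.closure_eq x hx]
    exact GeodesicControl.attractorSet_subset_closure_positiveOrbit x
  · refine (subset_iInter fun x ↦
      GeodesicControl.attractorSet_subset_closure_positiveOrbit x).antisymm ?_
    -- The single term at `a` already equals `A`.
    exact (iInter_subset _ a).trans (closure_orbit a haA).subset
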